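/- Setting. Let $n,m\ge 0$, let $\{U_\lambda\}_{\lambda\in K}$ be a (measurable) family of unitaries on $n+m$ qubits whose key $\lambda$ is drawn from a probability measure on $K$ (for instance, uniformly from a finite set), let $|\phi\rangle$ be an $n$-qubit unit vector, and let $E_1,E_j$ be elements of the Pauli group on $n+m$ qubits that are not scalar multiples of each other ($E_j$ is the true error, $E_1$ a wrong list element). Put $\Pi=I_n\otimes|0\rangle\langle 0|^{\otimes m}$, $$\rho_{\lambda,0}=E_jU_\lambda\big(|\phi\rangle\langle\phi|\otimes|0\rangle\langle0|^{\otimes m}\big)U_\lambda^\dagger E_j^\dagger,\qquad P_{\lambda,1}=1-\mathrm{Tr}\big[\Pi\,U_\lambda^\dagger E_1^\dagger\rho_{\lambda,0}E_1U_\lambda\big],$$ $$\rho_{\lambda,1}=\frac1{P_{\lambda,1}}\,E_1U_\lambda(I-\Pi)U_\lambda^\dagger E_1^\dagger\,\rho_{\lambda,0}\,E_1U_\lambda(I-\Pi)U_\lambda^\dagger E_1^\dagger ,$$ so that $\rho_{\lambda,1}$ is the state obtained from $\rho_{\lambda,0}$ by applying $U_\lambda^\dagger E_1^\dagger$, observing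 the outcome $I-\Pi$ of the measurement $\{\Pi,I-\Pi\}$ (which has probability $P_{\lambda,1}$), and applying $E_1U_\lambda$ (with $\rho_{\lambda,1}=0$ by convention if $P_{\lambda,1}=0$). Let $\mathcal F(\rho,\sigma)=\big(\mathrm{Tr}\sqrt{\sqrt\sigma\rho\sqrt\sigma}\big)^2$. For a random unitary $V$ let $\Phi_V^{(k)}(X)=\mathbb E\,V^{\otimes k}X(V^{\otimes k})^\dagger$, and let $\Phi^{(k)}_{\mathrm{Haar}}$ be this map for a Haar random unitary. The family is an exact 2-design if $\Phi_U^{(2)}=\Phi^{(2)}_{\mathrm{Haar}}$, and an approximate 4-design with relative error $\varepsilon$ if both $\Phi_U^{(4)}-(1-\varepsilon)\Phi^{(4)}_{\mathrm{Haar}}$ and $(1+\varepsilon)\Phi^{(4)}_{\mathrm{Haar}}-\Phi_U^{(4)}$ are completely positive. Claim. There is an absolute constant $C>0$ such that the following holds. (a) For all $n,m\ge0$, $\varepsilon\ge0$, $\delta>0$ and all $\{U_\lambda\}$, $|\phi\rangle$, $E_1$, $E_j$ as above, if $\{U_\lambda\}$ is an exact 2-design and an approximate 4-design with relative error $\varepsilon$,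 then $\mathcal F(\rho_{\lambda,1},\rho_{\lambda,0})=\mathrm{Tr}[\rho_{\lambda,1}\rho_{\lambda,0}]$ for every $\lambda$, and $$\Pr_\lambda\big[\mathcal F(\rho_{\lambda,1},\rho_{\lambda,0})\ge 1-\delta\big]\ \ge\ 1-C\,\frac{2^{-m}+\varepsilon}{\delta}.$$ (b) Let $m=m(n)=\omega(\log n)$. If $p=p(n)$ is at most polylogarithmic in $n$ with $p=\omega(\log n)$ and $m-p=\omega(\log n)$ (meaning that $p/\log n$ and $(m-p)/\log n$ tend to $+\infty$), if $\varepsilon(n)\ge0$ with $\varepsilon(n)=O(2^{-m(n)})$ (for instance $\varepsilon=2^{-m}$), and if $\delta(n)>0$ with $\delta(n)=\Theta(2^{-m(n)+p(n)})$, then both $\delta(n)$ and $C(2^{-m(n)}+\varepsilon(n))/\delta(n)$ are negligible, that is, for every $c\in\mathbb N$ they are smaller than $n^{-c}$ for all sufficiently large $n$. Moreover, for every $m=\omega(\log n)$ such a $p$ exists. -/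

import Mathlib

open scoped Kronecker ComplexOrder
open MeasureTheory Matrix Filter Asymptotics

noncomputable section

namespace QListDecoding

/-! ### The Haar measure on the unitary group -/

section Haar

variable (ι : Type*) [Fintype ι] [DecidableEq ι]

instance instMeasurableSpaceUnitary : MeasurableSpace (unitaryGroup ι ℂ) :=
  borel (unitaryGroup ι ℂ)

instance instBorelSpaceUnitary : BorelSpace (unitaryGroup ι ℂ) := ⟨rfl⟩

instance instCompactSpaceUnitary : CompactSpace (unitaryGroup ι ℂ) := by
  let S : Set (Matrix ι ι ℂ) :=
    Set.univ.pi fun _ : ι => Set.univ.pi fun _ : ι => Metric.closedBall (0 : ℂ) 1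
  have hS : IsCompact S :=
    isCompact_univ_pi fun _ => isCompact_univ_pi fun _ => isCompact_closedBall _ _
  refine isCompact_iff_compactSpace.mp (hS.of_isClosed_subset isClosed_unitary ?_)
  intro A hA i _ j _
  simpa using entry_norm_bound_of_unitary hA i j

/-- The Haar probability measure on the unitary group. -/
def haarUnitary : Measure (unitaryGroup ι ℂ) := Measure.haarMeasure ⊤

instance instIsProbabilityMeasureHaarUnitary : IsProbabilityMeasure (haarUnitary ι) :=
  ⟨Measure.haarMeasure_self (K₀ := (⊤ : TopologicalSpace.PositiveCompacts (unitaryGroup ι ℂ)))⟩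

end Haar

/-! ### Unitary designs -/

section Designs

variable {ι κ Ω : Type*} [Fintype ι] [DecidableEq ι]

/-- The tensor power `A^{⊗k}`, acting on the `k`-fold tensor power, whose standard basis is
indexed by `Fin k → ι`. -/
def tensorPow (k : ℕ) (A : Matrix ι ι ℂ) : Matrix (Fin k → ι) (Fin k → ι) ℂ :=
  Matrix.of fun f g => ∏ i, A (f i) (g i)

/-- The `k`-fold twirl `X ↦ 𝔼 [V^{⊗k} X (V^{⊗k})†]` of a random unitary `V` with
probability space `(Ω, μ)`; the expectation is taken entrywise. -/
def twirl [MeasurableSpace Ω] (μ : Measure Ω) (V : Ω → unitaryGroup ι ℂ) (k : ℕ)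
    (X : Matrix (Fin k → ι) (Fin k → ι) ℂ) : Matrix (Fin k → ι) (Fin k → ι) ℂ :=
  Matrix.of fun f g =>
    ∫ ω, (tensorPow k (V ω : Matrix ι ι ℂ) * X * (tensorPow k (V ω : Matrix ι ι ℂ))ᴴ) f g ∂μ

/-- The `k`-fold twirl of a Haar random unitary. -/
def haarTwirl (k : ℕ) (X : Matrix (Fin k → ι) (Fin k → ι) ℂ) :
    Matrix (Fin k → ι) (Fin k → ι) ℂ :=
  twirl (haarUnitary ι) id k X

/-- The ampliation `id_r ⊗ Φ` of a map `Φ` on matrices: `Φ` applied to each block. -/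
def ampliation (r : ℕ) (Φ : Matrix κ κ ℂ → Matrix κ κ ℂ)
    (X : Matrix (Fin r × κ) (Fin r × κ) ℂ) : Matrix (Fin r × κ) (Fin r × κ) ℂ :=
  Matrix.of fun p q => Φ (Matrix.of fun a b => X (p.1, a) (q.1, b)) p.2 q.2

/-- The order `Φ ⪯ Ψ` on (linear) maps of matrices: `Ψ - Φ` is completely positive. -/
def CPLe (Φ Ψ : Matrix κ κ ℂ → Matrix κ κ ℂ) : Prop :=
  ∀ (r : ℕ) (X : Matrix (Fin r × κ) (Fin r × κ) ℂ), X.PosSemidef →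
    (ampliation r (fun Y => Ψ Y - Φ Y) X).PosSemidef

/-- The random unitary `V` is an exact unitary `k`-design. -/
def IsExactDesign [MeasurableSpace Ω] (μ : Measure Ω) (V : Ω → unitaryGroup ι ℂ) (k : ℕ) :
    Prop :=
  ∀ X : Matrix (Fin k → ι) (Fin k → ι) ℂ, twirl μ V k X = haarTwirl k X

/-- The random unitary `V` is an approximate unitary `k`-design with relative error `ε`:
`(1 - ε) Φ_Haar ⪯ Φ_V ⪯ (1 + ε) Φ_Haar` for the `k`-fold twirls. -/
def IsRelApproxDesign [MeasurableSpace Ω] (μ : Measure Ω) (V : Ω → unitaryGroup ι ℂ) (k : ℕ)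
    (ε : ℝ) : Prop :=
  CPLe (fun X => (1 - ε) • haarTwirl k X) (twirl μ V k) ∧
    CPLe (twirl μ V k) (fun X => (1 + ε) • haarTwirl k X)

end Designs

/-! ### Fidelity -/

section Fidelity

open scoped MatrixOrder

variable {ι : Type*} [Fintype ι] [DecidableEq ι]

/-- The Uhlmann fidelity `(tr √(√σ ρ √σ))²`. -/
def fidelity (ρ σ : Matrix ι ι ℂ) : ℝ :=
  (CFC.sqrt (CFC.sqrt σ * ρ * CFC.sqrt σ)).trace.re ^ 2

end Fidelity

/-! ### Qubits, Pauli errors, and one step of the decoder -/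

/-- Bit strings of length `k`, labelling the computational basis of `k` qubits. -/
abbrev Bits (k : ℕ) : Type := Fin k → Fin 2

/-- Operators on `n` data qubits together with `m` tag qubits. -/
abbrev Op (n m : ℕ) : Type := Matrix (Bits n × Bits m) (Bits n × Bits m) ℂ

/-- The one-qubit matrices `I, X, Y, Z`. -/
def pauli : Fin 4 → Matrix (Fin 2) (Fin 2) ℂ :=
  ![1, !![0, 1; 1, 0], !![0, -Complex.I; Complex.I, 0], !![1, 0; 0, -1]]

/-- The tensor product of one-qubit matrices `I, X, Y, Z` on `k` qubits. -/
def pauliString {k : ℕ} (s : Fin k → Fin 4) : Matrix (Bits k) (Bits k) ℂ :=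
  Matrix.of fun x y => ∏ i, pauli (s i) (x i) (y i)

/-- Elements of the Pauli group on `n + m` qubits (with phases `±1, ±i`). -/
def IsPauli {n m : ℕ} (E : Op n m) : Prop :=
  ∃ (j : ℕ) (s : Fin n → Fin 4) (t : Fin m → Fin 4),
    E = Complex.I ^ j • (pauliString s ⊗ₖ pauliString t)

/-- The projector `|0⟩⟨0|^{⊗m}` on `m` qubits. -/
def zeroProj (m : ℕ) : Matrix (Bits m) (Bits m) ℂ := Matrix.single 0 0 1

/-- `Π = I_n ⊗ |0⟩⟨0|^{⊗m}`. -/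
def tagProj (n m : ℕ) : Op n m := (1 : Matrix (Bits n) (Bits n) ℂ) ⊗ₖ zeroProj m

/-- `|φ⟩⟨φ| ⊗ |0⟩⟨0|^{⊗m}`. -/
def taggedInput {n : ℕ} (m : ℕ) (φ : EuclideanSpace ℂ (Bits n)) : Op n m :=
  Matrix.vecMulVec φ.ofLp (star φ.ofLp) ⊗ₖ zeroProj m

section Step

variable {n m : ℕ}

/-- The state before the step, `ρ₀ = E_j U (|φ⟩⟨φ| ⊗ |0⟩⟨0|^{⊗m}) U† E_j†`. -/
def preState (Ej U : Op n m) (φ : EuclideanSpace ℂ (Bits n)) : Op n m :=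
  Ej * U * taggedInput m φ * Uᴴ * Ejᴴ

/-- The state on which `{Π, I - Π}` is measured, `U† E₁† ρ₀ E₁ U`. -/
def measuredState (E₁ Ej U : Op n m) (φ : EuclideanSpace ℂ (Bits n)) : Op n m :=
  Uᴴ * E₁ᴴ * preState Ej U φ * E₁ * U

/-- The probability `1 - tr (Π U† E₁† ρ₀ E₁ U)` of the outcome `I - Π`. -/
def rejectProb (E₁ Ej U : Op n m) (φ : EuclideanSpace ℂ (Bits n)) : ℝ :=
  1 - (tagProj n m * measuredState E₁ Ej U φ).trace.re

/-- The normalized state after the outcome `I - Π` and undoing the step, that is, applying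
`E₁ U`. It is `0` by convention if the outcome `I - Π` has probability zero. -/
def postState (E₁ Ej U : Op n m) (φ : EuclideanSpace ℂ (Bits n)) : Op n m :=
  (rejectProb E₁ Ej U φ)⁻¹ •
    (E₁ * U * ((1 - tagProj n m) * measuredState E₁ Ej U φ * (1 - tagProj n m)) * Uᴴ * E₁ᴴ)

end Step

/-! ### Growth conditions -/

/-- `f` is negligible: eventually smaller than every inverse power of `n`. -/
def Negligible (f : ℕ → ℝ) : Prop :=
  ∀ c : ℕ, ∃ n₀ : ℕ, ∀ n > n₀, f n < ((n : ℝ) ^ c)⁻¹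

/-- `f = ω(log n)`, with `f` eventually positive. -/
def SuperLog (f : ℕ → ℝ) : Prop :=
  ∀ c : ℝ, ∀ᶠ n : ℕ in atTop, c * Real.log n ≤ f n

/-- `f` is at most polylogarithmic, `f = O((log n)^k)` for some `k`. -/
def PolyLog (f : ℕ → ℝ) : Prop :=
  ∃ k : ℕ, f =O[atTop] fun n : ℕ => Real.log n ^ k

end QListDecoding

end

open QListDecoding

/-! The state before the step is pure, `|χ⟩⟨χ|`, and the step compresses it by the projector `R = E₁
U (1 - Π) U† E₁†` and renormalizes. Hence fidelity and overlap both equal `P = ⟨χ, R χ⟩`, the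
probability of the outcome `1 - Π` (`fidelity_postState`). It remains to show that the complementary
probability is small on average and to apply Markov's inequality.

Put `A = E₁† Ej`, which is unitary and traceless, and `B = U† A U`. The complementary probability is
the squared norm of `Π B (φ ⊗ 0)` (`rejectProb_eq`). By cyclicity of the trace it is linear in the
2-fold twirl, so its mean equals the Haar mean (`integral_acceptProb_eq_haar`).

The Haar mean is estimated by symmetry alone, without Weingarten calculus. Right invariance moves
`φ` to a basis vector and gives all off-diagonal entries of `B` the same second moment `g`. In
dimension `D = 2^(n+m)`, unit columns give `(D - 1) g ≤ 1`. A difference of two diagonal entries is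
a sum of two off-diagonal entries in a rotated frame, and the trace vanishes, so diagonal entries
have second moment at most `4 g`. Summing over the `2^n` entries of a column block gives at most `8
* 2^(-m)` (`integral_haar_acceptProb_le`). -/

namespace QListDecoding

/-! ### Tensor products of families of matrices -/

section Tensor

variable {ι : Type*} {k : ℕ}

/-- The tensor product of a finite family of matrices. -/
def tensorFamily (A : Fin k → Matrix ι ι ℂ) : Matrix (Fin k → ι) (Fin k → ι) ℂ :=
  Matrix.of fun f g => ∏ i, A i (f i) (g i)

lemma tensorFamily_apply (A : Fin k → Matrix ι ι ℂ) (f g : Fin k → ι) :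
    tensorFamily A f g = ∏ i, A i (f i) (g i) := rfl

lemma tensorFamily_conjTranspose (A : Fin k → Matrix ι ι ℂ) :
    (tensorFamily A)ᴴ = tensorFamily fun i => (A i)ᴴ := by
  ext f g
  simp [tensorFamily_apply]

lemma tensorFamily_one [DecidableEq ι] :
    tensorFamily (fun _ : Fin k => (1 : Matrix ι ι ℂ)) = 1 := by
  ext f g
  simp only [tensorFamily_apply, Matrix.one_apply, Finset.prod_ite_zero, Finset.prod_const_one,
    Finset.mem_univ, true_imp_iff, funext_iff]

variable [Fintype ι]

lemma tensorFamily_mul (A B : Fin k → Matrix ι ι ℂ) :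
    tensorFamily A * tensorFamily B = tensorFamily fun i => A i * B i := by
  ext f g
  simp only [Matrix.mul_apply, tensorFamily_apply, Finset.prod_univ_sum, Fintype.piFinset_univ,
    Finset.prod_mul_distrib]

lemma trace_tensorFamily (A : Fin k → Matrix ι ι ℂ) :
    (tensorFamily A).trace = ∏ i, (A i).trace := by
  simp only [Matrix.trace, Matrix.diag, tensorFamily_apply, Finset.prod_univ_sum,
    Fintype.piFinset_univ]

end Tensor

/-! ### Pauli matrices -/

lemma pauli_conjTranspose_mul_self (s : Fin 4) : (pauli s)ᴴ * pauli s = 1 := by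
  fin_cases s <;> ext i j <;> fin_cases i <;> fin_cases j <;>
    simp [pauli, Matrix.mul_apply, Fin.sum_univ_two]

lemma trace_pauli_conjTranspose_mul {s t : Fin 4} (h : s ≠ t) :
    ((pauli s)ᴴ * pauli t).trace = 0 := by
  fin_cases s <;> fin_cases t <;> first | exact absurd rfl h |
    simp [pauli, Matrix.mul_apply, Fin.sum_univ_two, Matrix.trace]

lemma pauliString_eq_tensorFamily {k : ℕ} (s : Fin k → Fin 4) :
    pauliString s = tensorFamily fun i => pauli (s i) := rfl

lemma pauliString_conjTranspose_mul_self {k : ℕ} (s : Fin k → Fin 4) :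
    (pauliString s)ᴴ * pauliString s = 1 := by
  simp only [pauliString_eq_tensorFamily, tensorFamily_conjTranspose, tensorFamily_mul,
    pauli_conjTranspose_mul_self, tensorFamily_one]

lemma trace_pauliString_conjTranspose_mul {k : ℕ} {s t : Fin k → Fin 4} (h : s ≠ t) :
    ((pauliString s)ᴴ * pauliString t).trace = 0 := by
  obtain ⟨i, hi⟩ := Function.ne_iff.mp h
  rw [pauliString_eq_tensorFamily, pauliString_eq_tensorFamily, tensorFamily_conjTranspose,
    tensorFamily_mul, trace_tensorFamily]
  exact Finset.prod_eq_zero (Finset.mem_univ i) (trace_pauli_conjTranspose_mul hi)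

lemma IsPauli.mem_unitaryGroup {n m : ℕ} {E : Op n m} (hE : IsPauli E) :
    E ∈ unitaryGroup (Bits n × Bits m) ℂ := by
  obtain ⟨j, s, t, rfl⟩ := hE
  rw [mem_unitaryGroup_iff', star_eq_conjTranspose, conjTranspose_smul, smul_mul_smul_comm,
    conjTranspose_kronecker, ← mul_kronecker_mul, pauliString_conjTranspose_mul_self,
    pauliString_conjTranspose_mul_self, one_kronecker_one, star_pow, ← mul_pow]
  simp

/-- The trace factors over qubits. Strings that differ at some qubit contribute a zero factor there;
equal strings would make `E` and `F` differ by a phase only. -/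
lemma IsPauli.trace_conjTranspose_mul {n m : ℕ} {E F : Op n m} (hE : IsPauli E) (hF : IsPauli F)
    (h : ∀ c : ℂ, E ≠ c • F) : (Eᴴ * F).trace = 0 := by
  obtain ⟨j, s, t, rfl⟩ := hE
  obtain ⟨j', s', t', rfl⟩ := hF
  rw [conjTranspose_smul, smul_mul_smul_comm, conjTranspose_kronecker, ← mul_kronecker_mul,
    trace_smul, trace_kronecker]
  by_cases hs : s = s'
  · by_cases ht : t = t'
    · subst hs ht
      refine absurd ?_ (h (Complex.I ^ j / Complex.I ^ j'))
      rw [smul_smul, div_mul_cancel₀ _ (pow_ne_zero _ Complex.I_ne_zero)]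
    · simp [trace_pauliString_conjTranspose_mul ht]
  · simp [trace_pauliString_conjTranspose_mul hs]

/-! ### Fidelity with a pure state -/

section PureFidelity

open scoped MatrixOrder

variable {ι : Type*} [Fintype ι]

/-- A projection is its own square root, so for `σ` a projection of trace one both square roots in
the fidelity are explicit. The hypothesis `h` is automatic when `σ` has rank one, with `P` the
overlap. -/
lemma fidelity_of_compress [DecidableEq ι] {ρ σ : Matrix ι ι ℂ} {P : ℝ} (hσ : σ.PosSemidef) (hσσ : σ * σ = σ)
    (htr : σ.trace = 1) (hP : 0 ≤ P) (h : σ * ρ * σ = (P : ℂ) • σ) : fidelity ρ σ = P := by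
  have h1 : CFC.sqrt σ = σ := CFC.sqrt_unique hσσ hσ.nonneg
  have h2 : CFC.sqrt ((P : ℂ) • σ) = ((√P : ℝ) : ℂ) • σ := by
    refine CFC.sqrt_unique ?_ (PosSemidef.nonneg ?_)
    · rw [smul_mul_smul_comm, hσσ, ← Complex.ofReal_mul, Real.mul_self_sqrt hP]
    · exact hσ.smul (by exact_mod_cast Real.sqrt_nonneg P)
  rw [fidelity, h1, h, h2, trace_smul, htr]
  simp [Real.sq_sqrt hP]

lemma trace_mul_of_compress {ρ σ : Matrix ι ι ℂ} {P : ℝ} (hσσ : σ * σ = σ)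
    (htr : σ.trace = 1) (h : σ * ρ * σ = (P : ℂ) • σ) : (ρ * σ).trace = P := by
  rw [← hσσ, ← Matrix.mul_assoc, trace_mul_comm, ← Matrix.mul_assoc, h, trace_smul, htr]
  simp

lemma vecMulVec_star_compress (v : ι → ℂ) (X : Matrix ι ι ℂ) :
    vecMulVec v (star v) * X * vecMulVec v (star v) =
      (star v ⬝ᵥ X *ᵥ v) • vecMulVec v (star v) := by
  rw [vecMulVec_mul, vecMulVec_mul_vecMulVec, dotProduct_mulVec]
  ext i j
  simp [vecMulVec_apply]
  ring

end PureFidelity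

/-! ### One step of the decoder -/

section Step

variable {n m : ℕ}

/-- The vector `|φ⟩ ⊗ |0⟩^{⊗m}`. -/
def taggedVec {n : ℕ} (m : ℕ) (φ : EuclideanSpace ℂ (Bits n)) : Bits n × Bits m → ℂ :=
  fun x => φ x.1 * if x.2 = 0 then 1 else 0

lemma taggedInput_eq (φ : EuclideanSpace ℂ (Bits n)) :
    taggedInput m φ = vecMulVec (taggedVec m φ) (star (taggedVec m φ)) := by
  ext ⟨x, y⟩ ⟨x', y'⟩
  simp only [taggedInput, zeroProj, kronecker_apply, vecMulVec_apply, taggedVec, Pi.star_apply,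
    single_apply, star_mul', apply_ite star, star_one, star_zero, eq_comm (a := (0 : Bits m)),
    ite_and]
  split_ifs <;> simp

lemma star_taggedVec_dotProduct (φ : EuclideanSpace ℂ (Bits n)) (hφ : ‖φ‖ = 1) :
    star (taggedVec m φ) ⬝ᵥ taggedVec m φ = 1 := by
  have h : (∑ x, star (φ x) * φ x : ℂ) = 1 := by
    have := EuclideanSpace.inner_eq_star_dotProduct φ φ
    rw [inner_self_eq_norm_sq_to_K, hφ, dotProduct_comm] at this
    simpa [dotProduct] using this.symm
  rw [dotProduct, Fintype.sum_prod_type]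
  simpa [taggedVec] using h

lemma preState_eq (Ej U : Op n m) (φ : EuclideanSpace ℂ (Bits n)) :
    preState Ej U φ =
      vecMulVec ((Ej * U) *ᵥ taggedVec m φ) (star ((Ej * U) *ᵥ taggedVec m φ)) := by
  rw [preState, taggedInput_eq, star_mulVec, ← mul_vecMulVec, ← vecMulVec_mul,
    conjTranspose_mul]
  simp only [Matrix.mul_assoc]

lemma tagProj_isHermitian : (tagProj n m)ᴴ = tagProj n m := by
  simp [tagProj, zeroProj, conjTranspose_kronecker, conjTranspose_single]

lemma tagProj_mul_self : tagProj n m * tagProj n m = tagProj n m := by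
  simp [tagProj, zeroProj, ← mul_kronecker_mul]

lemma star_mulVec_dotProduct_of_unitary {ι : Type*} [Fintype ι] [DecidableEq ι]
    {V : Matrix ι ι ℂ} (hV : Vᴴ * V = 1) (v : ι → ℂ) :
    star (V *ᵥ v) ⬝ᵥ V *ᵥ v = star v ⬝ᵥ v := by
  rw [star_mulVec, dotProduct_mulVec, vecMul_vecMul, hV, vecMul_one]

/-- Both the fidelity and the overlap of the states before and after the step equal the
probability of the outcome `I - Π`. -/
lemma fidelity_postState {E₁ Ej U : Op n m} (hE₁ : E₁ᴴ * E₁ = 1) (hEj : Ejᴴ * Ej = 1)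
    (hU : Uᴴ * U = 1) (φ : EuclideanSpace ℂ (Bits n)) (hφ : ‖φ‖ = 1) :
    fidelity (postState E₁ Ej U φ) (preState Ej U φ) = rejectProb E₁ Ej U φ ∧
      (postState E₁ Ej U φ * preState Ej U φ).trace = rejectProb E₁ Ej U φ := by
  set χ := (Ej * U) *ᵥ taggedVec m φ with hχ
  set R : Op n m := E₁ * U * (1 - tagProj n m) * Uᴴ * E₁ᴴ with hR
  have hV : (E₁ * U)ᴴ * (E₁ * U) = 1 := by
    rw [conjTranspose_mul, Matrix.mul_assoc, ← Matrix.mul_assoc _ E₁, hE₁, Matrix.one_mul, hU]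
  have hV' : (E₁ * U) * (E₁ * U)ᴴ = 1 := mul_eq_one_comm.mp hV
  have hχ1 : star χ ⬝ᵥ χ = 1 := by
    rw [hχ, star_mulVec_dotProduct_of_unitary, star_taggedVec_dotProduct φ hφ]
    rw [conjTranspose_mul, Matrix.mul_assoc, ← Matrix.mul_assoc _ Ej, hEj, Matrix.one_mul, hU]
  have hσ : preState Ej U φ = vecMulVec χ (star χ) := preState_eq Ej U φ
  have hσσ : preState Ej U φ * preState Ej U φ = preState Ej U φ := by
    rw [hσ, vecMulVec_mul_vecMulVec, hχ1, one_smul]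
  have htr : (preState Ej U φ).trace = 1 := by
    rw [hσ, trace_vecMulVec, dotProduct_comm, hχ1]
  have hQ : (1 - tagProj n m) * (1 - tagProj n m) = 1 - tagProj n m :=
    IsIdempotentElem.one_sub tagProj_mul_self
  have hRR : R * R = R := by
    have : R = (E₁ * U) * (1 - tagProj n m) * (E₁ * U)ᴴ := by
      rw [hR, conjTranspose_mul]; simp only [Matrix.mul_assoc]
    rw [this]
    calc _ = (E₁ * U) * ((1 - tagProj n m) * ((E₁ * U)ᴴ * (E₁ * U)) * (1 - tagProj n m)) *
          (E₁ * U)ᴴ := by simp only [Matrix.mul_assoc]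
      _ = _ := by
        rw [hV, Matrix.mul_one, hQ]
  have hRH : Rᴴ = R := by
    simp only [hR, conjTranspose_mul, conjTranspose_conjTranspose, conjTranspose_sub,
      conjTranspose_one, tagProj_isHermitian, Matrix.mul_assoc]
  -- Since `R` is a Hermitian projection, this is the squared norm of `R χ`; its nonnegativity makes
  -- `P` real and nonnegative.
  have ht : star χ ⬝ᵥ R *ᵥ χ = star (R *ᵥ χ) ⬝ᵥ (R *ᵥ χ) := by
    rw [star_mulVec R χ, hRH, ← dotProduct_mulVec, mulVec_mulVec χ R R, hRR]
  set P := rejectProb E₁ Ej U φ with hP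
  have hacc : (tagProj n m * measuredState E₁ Ej U φ).trace = 1 - star χ ⬝ᵥ R *ᵥ χ := by
    have h1 : star χ ⬝ᵥ R *ᵥ χ = (R * preState Ej U φ).trace := by
      rw [hσ, mul_vecMulVec, trace_vecMulVec, dotProduct_comm]
    have h2 : R = 1 - E₁ * U * tagProj n m * Uᴴ * E₁ᴴ := by
      rw [hR, Matrix.mul_sub, Matrix.sub_mul, Matrix.sub_mul, Matrix.mul_one,
        Matrix.mul_assoc (E₁ * U), ← conjTranspose_mul, hV', Matrix.mul_assoc _ Uᴴ,
        ← conjTranspose_mul]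
    rw [h1, h2, Matrix.sub_mul, trace_sub, Matrix.one_mul, htr, sub_sub_cancel, measuredState]
    rw [show E₁ * U * tagProj n m * Uᴴ * E₁ᴴ * preState Ej U φ =
      (E₁ * U) * (tagProj n m * (Uᴴ * E₁ᴴ * preState Ej U φ)) by simp only [Matrix.mul_assoc],
      trace_mul_comm (E₁ * U)]
    simp only [Matrix.mul_assoc]
  have hpos : 0 ≤ star χ ⬝ᵥ R *ᵥ χ := by
    rw [ht]; exact dotProduct_star_self_nonneg _
  have hPt : (P : ℂ) = star χ ⬝ᵥ R *ᵥ χ := by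
    obtain ⟨h0, h1⟩ := Complex.le_def.mp hpos
    refine Complex.ext ?_ (by simpa using h1)
    simp [hP, rejectProb, hacc]
  have hP0 : 0 ≤ P := by
    rw [← hPt] at hpos
    exact_mod_cast hpos
  have hpost : postState E₁ Ej U φ = ((P⁻¹ : ℝ) : ℂ) • (R * preState Ej U φ * R) := by
    rw [postState, measuredState, hR, hP, Complex.coe_smul]
    simp only [Matrix.mul_assoc]
  have hcomp : preState Ej U φ * postState E₁ Ej U φ * preState Ej U φ =
      (P : ℂ) • preState Ej U φ := by
    have h3 : preState Ej U φ * R * preState Ej U φ = (P : ℂ) • preState Ej U φ := by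
      rw [hσ, vecMulVec_star_compress, hPt]
    calc _ = ((P⁻¹ : ℝ) : ℂ) • ((preState Ej U φ * R * preState Ej U φ) * R * preState Ej U φ) := by
          rw [hpost, Matrix.mul_smul, Matrix.smul_mul]
          simp only [Matrix.mul_assoc]
      _ = _ := by
          rw [h3, Matrix.smul_mul, Matrix.smul_mul, h3, smul_smul, smul_smul]
          congr 1
          -- If `P = 0`, the convention `0⁻¹ = 0` makes the post-state zero and both sides vanish.
          rcases eq_or_ne P 0 with h | h
          · simp [h]
          · have : (P : ℂ) ≠ 0 := by exact_mod_cast h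
            push_cast; field_simp
  refine ⟨fidelity_of_compress ?_ hσσ htr hP0 hcomp, trace_mul_of_compress hσσ htr hcomp⟩
  rw [hσ]
  exact posSemidef_vecMulVec_self_star χ

end Step

/-! ### Entries of conjugated matrices as sesquilinear forms and as twirl entries -/

section MatrixEntries

variable {ι : Type*} [Fintype ι]

lemma inner_toLp (u w : ι → ℂ) :
    inner ℂ (WithLp.toLp 2 u) (WithLp.toLp 2 w) = star u ⬝ᵥ w := by
  rw [EuclideanSpace.inner_eq_star_dotProduct, dotProduct_comm]

lemma conj_apply_eq_dotProduct {B W : Matrix ι ι ℂ} {b c : ι} {u w : ι → ℂ}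
    (hu : ∀ i, W i b = u i) (hw : ∀ i, W i c = w i) :
    (Wᴴ * B * W) b c = star u ⬝ᵥ B *ᵥ w := by
  rw [Matrix.mul_assoc]
  simp only [Matrix.mul_apply, conjTranspose_apply, dotProduct, mulVec, hu, hw, Pi.star_apply]

lemma tensorPow_two_conj_apply (V M N : Matrix ι ι ℂ) (a b c d : ι) :
    (tensorPow 2 V * tensorFamily ![M, N] * (tensorPow 2 V)ᴴ) ![a, c] ![b, d] =
      (V * M * Vᴴ) a b * (V * N * Vᴴ) c d := by
  rw [show tensorPow 2 V = tensorFamily fun _ => V from rfl, tensorFamily_conjTranspose,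
    tensorFamily_mul, tensorFamily_mul, tensorFamily_apply, Fin.prod_univ_two]
  simp

lemma star_single_dotProduct_mulVec_single [DecidableEq ι] (B : Matrix ι ι ℂ) (x y : ι) :
    star (Pi.single x 1 : ι → ℂ) ⬝ᵥ B *ᵥ Pi.single y 1 = B x y := by
  simp

end MatrixEntries

/-! ### Haar integrals on the unitary group -/

section HaarMoments

variable {ι : Type*} [Fintype ι] [DecidableEq ι]

instance instIsHaarMeasureHaarUnitary : (haarUnitary ι).IsHaarMeasure :=
  Measure.isHaarMeasure_haarMeasure _

/-- A right translate of the Haar measure is again a left Haar probability measure, so uniqueness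
identifies the two. -/
instance instIsMulRightInvariantHaarUnitary : (haarUnitary ι).IsMulRightInvariant where
  map_mul_right_eq_self g := by
    have : IsProbabilityMeasure (Measure.map (· * g) (haarUnitary ι)) :=
      Measure.isProbabilityMeasure_map (measurable_mul_const g).aemeasurable
    exact Measure.isHaarMeasure_eq_of_isProbabilityMeasure _ _

lemma integrable_continuous_comp {Ω E : Type*} [MeasurableSpace Ω] {μ : Measure Ω}
    [IsFiniteMeasure μ] [NormedAddCommGroup E] [MeasurableSpace E] [BorelSpace E]
    [SecondCountableTopology E] {V : Ω → unitaryGroup ι ℂ} (hV : Measurable V)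
    {g : unitaryGroup ι ℂ → E} (hg : Continuous g) : Integrable (fun ω => g (V ω)) μ := by
  obtain ⟨C, hC⟩ := isCompact_univ.exists_bound_of_continuousOn hg.continuousOn
  exact Integrable.of_bound (hg.measurable.comp hV).aestronglyMeasurable C
    (ae_of_all _ fun ω => hC _ (Set.mem_univ _))

lemma integrable_haarUnitary {E : Type*} [NormedAddCommGroup E] [MeasurableSpace E] [BorelSpace E]
    [SecondCountableTopology E] {g : unitaryGroup ι ℂ → E} (hg : Continuous g) :
    Integrable g (haarUnitary ι) :=
  integrable_continuous_comp (V := id) measurable_id hg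

/-- The conjugate `V† A V`. -/
def conjBy (A : Matrix ι ι ℂ) (V : unitaryGroup ι ℂ) : Matrix ι ι ℂ :=
  (V : Matrix ι ι ℂ)ᴴ * A * (V : Matrix ι ι ℂ)

lemma continuous_conjBy (A : Matrix ι ι ℂ) : Continuous (conjBy A) :=
  (continuous_subtype_val.matrix_conjTranspose.matrix_mul continuous_const).matrix_mul
    continuous_subtype_val

lemma unitary_conjTranspose_mul_self (V : unitaryGroup ι ℂ) :
    (V : Matrix ι ι ℂ)ᴴ * (V : Matrix ι ι ℂ) = 1 :=
  mem_unitaryGroup_iff'.mp V.2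

lemma unitary_mul_conjTranspose_self (V : unitaryGroup ι ℂ) :
    (V : Matrix ι ι ℂ) * (V : Matrix ι ι ℂ)ᴴ = 1 :=
  mem_unitaryGroup_iff.mp V.2

lemma conjBy_mul (A : Matrix ι ι ℂ) (V W : unitaryGroup ι ℂ) :
    conjBy A (V * W) = (W : Matrix ι ι ℂ)ᴴ * conjBy A V * (W : Matrix ι ι ℂ) := by
  simp only [conjBy, Submonoid.coe_mul, conjTranspose_mul, Matrix.mul_assoc]

lemma conjBy_conjTranspose (A : Matrix ι ι ℂ) (V : unitaryGroup ι ℂ) :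
    (conjBy A V)ᴴ = conjBy Aᴴ V := by
  simp only [conjBy, conjTranspose_mul, conjTranspose_conjTranspose, Matrix.mul_assoc]

lemma conjBy_conjTranspose_mul_self {A : Matrix ι ι ℂ} (hA : Aᴴ * A = 1)
    (V : unitaryGroup ι ℂ) : (conjBy A V)ᴴ * conjBy A V = 1 := by
  calc (conjBy A V)ᴴ * conjBy A V = (V : Matrix ι ι ℂ)ᴴ *
        (Aᴴ * (((V : Matrix ι ι ℂ) * (V : Matrix ι ι ℂ)ᴴ) * A)) * (V : Matrix ι ι ℂ) := by
        rw [conjBy_conjTranspose]; simp only [conjBy, Matrix.mul_assoc]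
    _ = 1 := by
        rw [unitary_mul_conjTranspose_self, Matrix.one_mul, hA, Matrix.mul_one,
          unitary_conjTranspose_mul_self]

lemma trace_conjBy (A : Matrix ι ι ℂ) (V : unitaryGroup ι ℂ) :
    (conjBy A V).trace = A.trace := by
  rw [conjBy, trace_mul_comm, ← Matrix.mul_assoc, unitary_mul_conjTranspose_self, Matrix.one_mul]

/-- Right invariance of the Haar measure, for functions of `V† A V`. -/
lemma integral_conjBy {E : Type*} [NormedAddCommGroup E] [NormedSpace ℝ E]
    (A : Matrix ι ι ℂ) (F : Matrix ι ι ℂ → E) (W : unitaryGroup ι ℂ) :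
    ∫ V, F ((W : Matrix ι ι ℂ)ᴴ * conjBy A V * (W : Matrix ι ι ℂ)) ∂haarUnitary ι =
      ∫ V, F (conjBy A V) ∂haarUnitary ι := by
  simp only [← conjBy_mul]
  exact integral_mul_right_eq_self (fun V => F (conjBy A V)) W

/-- Extending to an orthonormal basis allows the columns indexed by `s` to be prescribed; right
translation by such a `W` transports moments between frames. -/
lemma exists_unitary_of_orthonormal {v : ι → EuclideanSpace ℂ ι} {s : Set ι}
    (hv : Orthonormal ℂ (s.domRestrict v)) :
    ∃ W : unitaryGroup ι ℂ, ∀ j ∈ s, ∀ i, (W : Matrix ι ι ℂ) i j = v j i := by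
  obtain ⟨b, hb⟩ := hv.exists_orthonormalBasis_extension_of_card_eq (by simp)
  refine ⟨⟨_, (EuclideanSpace.basisFun ι ℂ).toMatrix_orthonormalBasis_mem_unitary b⟩,
    fun j hj i => ?_⟩
  simp [Module.Basis.toMatrix_apply, hb j hj]

lemma exists_unitary_of_orthonormal_pair {b c : ι} (hbc : b ≠ c) {u w : ι → ℂ}
    (hu : star u ⬝ᵥ u = 1) (hw : star w ⬝ᵥ w = 1) (huw : star u ⬝ᵥ w = 0) :
    ∃ W : unitaryGroup ι ℂ, (∀ i, (W : Matrix ι ι ℂ) i b = u i) ∧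
      ∀ i, (W : Matrix ι ι ℂ) i c = w i := by
  have hwu : star w ⬝ᵥ u = 0 := by
    rw [star_dotProduct, huw, star_zero]
  obtain ⟨W, hW⟩ := exists_unitary_of_orthonormal (s := {b, c})
    (v := fun j => if j = b then WithLp.toLp 2 u else WithLp.toLp 2 w) (by
      rw [orthonormal_iff_ite]
      rintro ⟨i, hi⟩ ⟨j, hj⟩
      simp only [Set.mem_insert_iff, Set.mem_singleton_iff] at hi hj
      rcases hi with rfl | rfl <;> rcases hj with rfl | rfl <;>
        simp only [Set.domRestrict_apply, Subtype.mk.injEq, inner_toLp, hu, hw, huw, hwu, hbc,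
          hbc.symm, if_true, if_false])
  exact ⟨W, fun i => by simpa using hW b (by simp) i,
    fun i => by simpa [hbc.symm] using hW c (by simp) i⟩

/-- All off-diagonal second moments of `V† A V` in orthonormal frames agree. -/
lemma integral_norm_sq_orthonormal_pair (A : Matrix ι ι ℂ) {b c : ι} (hbc : b ≠ c) {u w : ι → ℂ}
    (hu : star u ⬝ᵥ u = 1) (hw : star w ⬝ᵥ w = 1) (huw : star u ⬝ᵥ w = 0) :
    ∫ V, ‖star u ⬝ᵥ conjBy A V *ᵥ w‖ ^ 2 ∂haarUnitary ι =
      ∫ V, ‖conjBy A V b c‖ ^ 2 ∂haarUnitary ι := by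
  obtain ⟨W, hWb, hWc⟩ := exists_unitary_of_orthonormal_pair hbc hu hw huw
  rw [← integral_conjBy A (fun B => ‖B b c‖ ^ 2) W]
  simp only [conj_apply_eq_dotProduct hWb hWc]

lemma integral_norm_sq_offDiag_eq (A : Matrix ι ι ℂ) {b c x y : ι} (hbc : b ≠ c) (hxy : x ≠ y) :
    ∫ V, ‖conjBy A V x y‖ ^ 2 ∂haarUnitary ι = ∫ V, ‖conjBy A V b c‖ ^ 2 ∂haarUnitary ι := by
  have := integral_norm_sq_orthonormal_pair A hbc (u := Pi.single x 1) (w := Pi.single y 1)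
    (by simp) (by simp) (by simp [hxy])
  simpa only [star_single_dotProduct_mulVec_single] using this

lemma integrable_norm_sq_conjBy (A : Matrix ι ι ℂ) {f : Matrix ι ι ℂ → ℂ} (hf : Continuous f) :
    Integrable (fun V => ‖f (conjBy A V)‖ ^ 2) (haarUnitary ι) :=
  integrable_haarUnitary ((hf.comp (continuous_conjBy A)).norm.pow 2)

lemma sum_norm_sq_column {B : Matrix ι ι ℂ} (hB : Bᴴ * B = 1) (y : ι) :
    ∑ x, ‖B x y‖ ^ 2 = 1 := by
  have h := congrFun (congrFun hB y) y
  simp only [Matrix.mul_apply, conjTranspose_apply, one_apply_eq, RCLike.star_def,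
    Complex.conj_mul'] at h
  exact_mod_cast h

/-- A column of a unitary has norm one, and its off-diagonal entries, one fewer than the dimension,
all have the same second moment. -/
lemma card_sub_one_mul_integral_offDiag_le {A : Matrix ι ι ℂ} (hA : Aᴴ * A = 1) {b c : ι}
    (hbc : b ≠ c) :
    ((Fintype.card ι : ℝ) - 1) * ∫ V, ‖conjBy A V b c‖ ^ 2 ∂haarUnitary ι ≤ 1 := by
  have hint : ∀ x, Integrable (fun V => ‖conjBy A V x c‖ ^ 2) (haarUnitary ι) := fun x =>
    integrable_norm_sq_conjBy A (f := fun B => B x c) (continuous_id.matrix_elem x c)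
  have htot : ∑ x, ∫ V, ‖conjBy A V x c‖ ^ 2 ∂haarUnitary ι = 1 := by
    rw [← integral_finsetSum _ fun x _ => hint x]
    simp only [sum_norm_sq_column (conjBy_conjTranspose_mul_self hA _)]
    simp
  rw [← Finset.add_sum_erase _ _ (Finset.mem_univ c), Finset.sum_congr rfl fun x hx =>
    integral_norm_sq_offDiag_eq A hbc (Finset.ne_of_mem_erase hx), Finset.sum_const,
    Finset.card_erase_of_mem (Finset.mem_univ c), Finset.card_univ, nsmul_eq_mul,
    Nat.cast_pred (Fintype.card_pos_iff.mpr ⟨c⟩)] at htot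
  have : 0 ≤ ∫ V, ‖conjBy A V c c‖ ^ 2 ∂haarUnitary ι := integral_nonneg fun _ => by positivity
  linarith

/-- The frame is `(e_b ± e_c) / √2`. It turns a diagonal difference into off-diagonal entries, whose
moments are already controlled. -/
lemma exists_orthonormal_pair_diag_sub {b c : ι} (hbc : b ≠ c) :
    ∃ u w : ι → ℂ, star u ⬝ᵥ u = 1 ∧ star w ⬝ᵥ w = 1 ∧ star u ⬝ᵥ w = 0 ∧ star w ⬝ᵥ u = 0 ∧
      ∀ B : Matrix ι ι ℂ, B b b - B c c = star u ⬝ᵥ B *ᵥ w + star w ⬝ᵥ B *ᵥ u := by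
  obtain ⟨r, hrr, hrs⟩ : ∃ r : ℂ, r * r = 1 / 2 ∧ star r = r := by
    refine ⟨((√2)⁻¹ : ℝ), ?_, Complex.conj_ofReal _⟩
    rw [← Complex.ofReal_mul, ← mul_inv, Real.mul_self_sqrt (by norm_num)]
    norm_num
  refine ⟨Pi.single b r + Pi.single c r, Pi.single b r - Pi.single c r, ?_, ?_, ?_, ?_, ?_⟩
  · simp only [star_add, ← Pi.single_star, hrs, dotProduct_add, dotProduct_single, Pi.add_apply,
      Pi.single_eq_same, Pi.single_eq_of_ne hbc, Pi.single_eq_of_ne hbc.symm]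
    linear_combination 2 * hrr
  · simp only [star_sub, ← Pi.single_star, hrs, dotProduct_sub, dotProduct_single, Pi.sub_apply,
      Pi.single_eq_same, Pi.single_eq_of_ne hbc, Pi.single_eq_of_ne hbc.symm]
    linear_combination 2 * hrr
  · simp only [star_add, ← Pi.single_star, hrs, dotProduct_sub, dotProduct_single, Pi.add_apply,
      Pi.single_eq_same, Pi.single_eq_of_ne hbc, Pi.single_eq_of_ne hbc.symm]
    ring
  · simp only [star_sub, ← Pi.single_star, hrs, dotProduct_add, dotProduct_single, Pi.sub_apply,
      Pi.single_eq_same, Pi.single_eq_of_ne hbc, Pi.single_eq_of_ne hbc.symm]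
    ring
  · intro B
    simp only [star_add, star_sub, ← Pi.single_star, hrs, mulVec_add, mulVec_sub, dotProduct_add,
      dotProduct_sub, add_dotProduct, sub_dotProduct, single_dotProduct, mulVec_single,
      Pi.smul_apply, Matrix.col_apply, MulOpposite.smul_eq_mul_unop, MulOpposite.unop_op]
    linear_combination (2 * B c c - 2 * B b b) * hrr

lemma integral_norm_sq_diag_sub_le (A : Matrix ι ι ℂ) {b c : ι} (hbc : b ≠ c) :
    ∫ V, ‖conjBy A V b b - conjBy A V c c‖ ^ 2 ∂haarUnitary ι ≤
      4 * ∫ V, ‖conjBy A V b c‖ ^ 2 ∂haarUnitary ι := by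
  obtain ⟨u, w, huu, hww, huw, hwu, key⟩ := exists_orthonormal_pair_diag_sub hbc
  have hle : ∀ V, ‖conjBy A V b b - conjBy A V c c‖ ^ 2 ≤
      2 * ‖star u ⬝ᵥ conjBy A V *ᵥ w‖ ^ 2 + 2 * ‖star w ⬝ᵥ conjBy A V *ᵥ u‖ ^ 2 := by
    intro V
    rw [key]
    have h1 := norm_add_le (star u ⬝ᵥ conjBy A V *ᵥ w) (star w ⬝ᵥ conjBy A V *ᵥ u)
    have h2 := norm_nonneg (star u ⬝ᵥ conjBy A V *ᵥ w + star w ⬝ᵥ conjBy A V *ᵥ u)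
    nlinarith [sq_nonneg (‖star u ⬝ᵥ conjBy A V *ᵥ w‖ - ‖star w ⬝ᵥ conjBy A V *ᵥ u‖)]
  have hc : ∀ x y : ι → ℂ, Continuous fun B : Matrix ι ι ℂ => star x ⬝ᵥ B *ᵥ y := fun x y =>
    continuous_const.dotProduct (continuous_id.matrix_mulVec continuous_const)
  have hi : ∀ x y : ι → ℂ, Integrable (fun V => 2 * ‖star x ⬝ᵥ conjBy A V *ᵥ y‖ ^ 2)
      (haarUnitary ι) := fun x y => (integrable_norm_sq_conjBy A (hc x y)).const_mul 2
  have hd : Integrable (fun V => ‖conjBy A V b b - conjBy A V c c‖ ^ 2) (haarUnitary ι) :=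
    integrable_norm_sq_conjBy A (f := fun B => B b b - B c c)
      ((continuous_id.matrix_elem b b).sub (continuous_id.matrix_elem c c))
  refine (integral_mono hd ((hi u w).add (hi w u)) hle).trans (le_of_eq ?_)
  rw [integral_add' (hi u w) (hi w u), integral_const_mul, integral_const_mul,
    integral_norm_sq_orthonormal_pair A hbc huu hww huw,
    integral_norm_sq_orthonormal_pair A hbc hww huu hwu]
  ring

/-- As the trace vanishes, `B b b` is the average over `x` of the differences `B b b - B x x`;
Cauchy-Schwarz reduces the claim to `integral_norm_sq_diag_sub_le`. -/
lemma integral_norm_sq_diag_le {A : Matrix ι ι ℂ} (htr : A.trace = 0) {b c : ι} (hbc : b ≠ c) :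
    ∫ V, ‖conjBy A V b b‖ ^ 2 ∂haarUnitary ι ≤
      4 * ∫ V, ‖conjBy A V b c‖ ^ 2 ∂haarUnitary ι := by
  set g := ∫ V, ‖conjBy A V b c‖ ^ 2 ∂haarUnitary ι with hg
  have hg0 : 0 ≤ g := integral_nonneg fun _ => by positivity
  set D : ℝ := (Fintype.card ι : ℝ) with hD
  have hD0 : 0 < D := by
    rw [hD]; exact_mod_cast Fintype.card_pos_iff.mpr ⟨b⟩
  have hint : ∀ x, Integrable (fun V => ‖conjBy A V b b - conjBy A V x x‖ ^ 2)
      (haarUnitary ι) := fun x => integrable_norm_sq_conjBy A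
    (f := fun B => B b b - B x x) ((continuous_id.matrix_elem b b).sub (continuous_id.matrix_elem x x))
  have hle : ∀ V, D ^ 2 * ‖conjBy A V b b‖ ^ 2 ≤
      D * ∑ x, ‖conjBy A V b b - conjBy A V x x‖ ^ 2 := by
    intro V
    have h1 : (Fintype.card ι : ℂ) * conjBy A V b b =
        ∑ x, (conjBy A V b b - conjBy A V x x) := by
      have h2 : ∑ x, conjBy A V x x = 0 := (trace_conjBy A V).trans htr
      rw [Finset.sum_sub_distrib, h2, Finset.sum_const, Finset.card_univ, nsmul_eq_mul, sub_zero]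
    calc D ^ 2 * ‖conjBy A V b b‖ ^ 2 = ‖(Fintype.card ι : ℂ) * conjBy A V b b‖ ^ 2 := by
          rw [norm_mul, mul_pow]; simp [hD]
      _ ≤ (∑ x, ‖conjBy A V b b - conjBy A V x x‖) ^ 2 := by
          rw [h1]; gcongr; exact norm_sum_le _ _
      _ ≤ _ := by
          have := sq_sum_le_card_mul_sum_sq (s := Finset.univ)
            (f := fun x => ‖conjBy A V b b - conjBy A V x x‖)
          simpa [hD] using this
  have hsum : ∑ x, ∫ V, ‖conjBy A V b b - conjBy A V x x‖ ^ 2 ∂haarUnitary ι ≤ D * (4 * g) := by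
    rw [hD, ← Finset.card_univ, ← nsmul_eq_mul]
    refine Finset.sum_le_card_nsmul _ _ _ fun x _ => ?_
    -- The term `x = b` vanishes; the others are bounded by the common off-diagonal moment.
    rcases eq_or_ne b x with rfl | hx
    · simpa using hg0
    · rw [hg, ← integral_norm_sq_offDiag_eq A hbc hx]
      exact integral_norm_sq_diag_sub_le A hx
  have hfin : D ^ 2 * ∫ V, ‖conjBy A V b b‖ ^ 2 ∂haarUnitary ι ≤ D * (D * (4 * g)) := by
    rw [← integral_const_mul]
    refine (integral_mono ((integrable_norm_sq_conjBy A
      (f := fun B => B b b) (continuous_id.matrix_elem b b)).const_mul _)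
      ((integrable_finsetSum _ fun x _ => hint x).const_mul D) hle).trans ?_
    rw [integral_const_mul, integral_finsetSum _ fun x _ => hint x]
    gcongr
  have : D ^ 2 * ∫ V, ‖conjBy A V b b‖ ^ 2 ∂haarUnitary ι ≤ D ^ 2 * (4 * g) := by linarith
  exact le_of_mul_le_mul_left this (by positivity)

end HaarMoments

/-! ### Second moments of an exact 2-design -/

section TwoDesign

variable {ι Ω : Type*} [Fintype ι] [DecidableEq ι] [MeasurableSpace Ω] {μ : Measure Ω}
  [IsFiniteMeasure μ]

/-- The trace is a fixed linear combination of products of one entry from each conjugate, and the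
mean of such a product is an entry of the 2-fold twirl. Equal twirls therefore give equal integrals.
-/
lemma integral_trace_eq_sum_twirl {V : Ω → unitaryGroup ι ℂ} (hV : Measurable V)
    (M N A B : Matrix ι ι ℂ) :
    ∫ ω, (((V ω : Matrix ι ι ℂ) * M * (V ω : Matrix ι ι ℂ)ᴴ) * A *
        ((V ω : Matrix ι ι ℂ) * N * (V ω : Matrix ι ι ℂ)ᴴ) * B).trace ∂μ =
      ∑ a, ∑ d, ∑ c, ∑ b, A b c * B d a *
        twirl μ V 2 (tensorFamily ![M, N]) ![a, c] ![b, d] := by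
  have hcont : ∀ (X : Matrix ι ι ℂ) (i j : ι), Continuous fun W : unitaryGroup ι ℂ =>
      ((W : Matrix ι ι ℂ) * X * (W : Matrix ι ι ℂ)ᴴ) i j := fun X i j =>
    ((continuous_subtype_val.matrix_mul continuous_const).matrix_mul
      continuous_subtype_val.matrix_conjTranspose).matrix_elem i j
  have hint : ∀ a d c b, Integrable (fun ω => A b c * B d a *
      (((V ω : Matrix ι ι ℂ) * M * (V ω : Matrix ι ι ℂ)ᴴ) a b *
        ((V ω : Matrix ι ι ℂ) * N * (V ω : Matrix ι ι ℂ)ᴴ) c d)) μ := fun a d c b =>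
    (integrable_continuous_comp hV ((hcont M a b).mul (hcont N c d))).const_mul _
  have hexp : ∀ P Q : Matrix ι ι ℂ, (P * A * Q * B).trace =
      ∑ a, ∑ d, ∑ c, ∑ b, A b c * B d a * (P a b * Q c d) := by
    intro P Q
    simp only [trace, diag_apply, Matrix.mul_apply, Finset.sum_mul]
    refine Finset.sum_congr rfl fun a _ => Finset.sum_congr rfl fun d _ =>
      Finset.sum_congr rfl fun c _ => Finset.sum_congr rfl fun b _ => by ring
  simp only [hexp]
  rw [integral_finsetSum _ fun a _ => integrable_finsetSum _ fun d _ =>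
    integrable_finsetSum _ fun c _ => integrable_finsetSum _ fun b _ => hint a d c b]
  refine Finset.sum_congr rfl fun a _ => ?_
  rw [integral_finsetSum _ fun d _ => integrable_finsetSum _ fun c _ =>
    integrable_finsetSum _ fun b _ => hint a d c b]
  refine Finset.sum_congr rfl fun d _ => ?_
  rw [integral_finsetSum _ fun c _ => integrable_finsetSum _ fun b _ => hint a d c b]
  refine Finset.sum_congr rfl fun c _ => ?_
  rw [integral_finsetSum _ fun b _ => hint a d c b]
  refine Finset.sum_congr rfl fun b _ => ?_
  rw [integral_const_mul, twirl, of_apply]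
  simp only [tensorPow_two_conj_apply]

lemma IsExactDesign.integral_trace {V : Ω → unitaryGroup ι ℂ} (h : IsExactDesign μ V 2)
    (hV : Measurable V) (M N A B : Matrix ι ι ℂ) :
    ∫ ω, (((V ω : Matrix ι ι ℂ) * M * (V ω : Matrix ι ι ℂ)ᴴ) * A *
        ((V ω : Matrix ι ι ℂ) * N * (V ω : Matrix ι ι ℂ)ᴴ) * B).trace ∂μ =
      ∫ W : unitaryGroup ι ℂ, (((W : Matrix ι ι ℂ) * M * (W : Matrix ι ι ℂ)ᴴ) * A *
        ((W : Matrix ι ι ℂ) * N * (W : Matrix ι ι ℂ)ᴴ) * B).trace ∂haarUnitary ι := by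
  rw [integral_trace_eq_sum_twirl hV, h]
  exact (integral_trace_eq_sum_twirl (V := id) measurable_id M N A B).symm

end TwoDesign

/-! ### The probability of the outcome `Π` -/

section Accept

variable {n m : ℕ}

/-- The squared norm of the `|0⟩^{⊗m}`-component of `B (|φ⟩ ⊗ |0⟩^{⊗m})`. -/
noncomputable def acceptProb (B : Op n m) (φ : EuclideanSpace ℂ (Bits n)) : ℝ :=
  ∑ x : Bits n, ‖(B *ᵥ taggedVec m φ) (x, 0)‖ ^ 2

lemma acceptProb_nonneg (B : Op n m) (φ : EuclideanSpace ℂ (Bits n)) : 0 ≤ acceptProb B φ :=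
  Finset.sum_nonneg fun _ _ => by positivity

lemma continuous_acceptProb (φ : EuclideanSpace ℂ (Bits n)) :
    Continuous fun B : Op n m => acceptProb B φ :=
  continuous_finsetSum _ fun x _ =>
    (((continuous_apply (x, (0 : Bits m))).comp
      (continuous_id.matrix_mulVec continuous_const)).norm).pow 2

lemma tagProj_eq_diagonal :
    tagProj n m = diagonal fun x : Bits n × Bits m => if x.2 = 0 then (1 : ℂ) else 0 := by
  rw [tagProj, zeroProj, ← diagonal_single, ← diagonal_one, diagonal_kronecker_diagonal]
  congr 1
  ext ⟨x, y⟩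
  simp [Pi.single_apply]

lemma trace_tagProj_mul_conj (B : Op n m) (φ : EuclideanSpace ℂ (Bits n)) :
    (tagProj n m * (B * taggedInput m φ * Bᴴ)).trace = acceptProb B φ := by
  rw [taggedInput_eq, mul_vecMulVec, vecMulVec_mul, ← star_mulVec, tagProj_eq_diagonal, trace,
    Fintype.sum_prod_type, acceptProb, Complex.ofReal_sum]
  refine Finset.sum_congr rfl fun x _ => ?_
  simp [diagonal_mul, vecMulVec_apply, Complex.mul_conj']

lemma rejectProb_eq (E₁ Ej : Op n m) (V : unitaryGroup (Bits n × Bits m) ℂ)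
    (φ : EuclideanSpace ℂ (Bits n)) :
    rejectProb E₁ Ej V φ = 1 - acceptProb (conjBy (E₁ᴴ * Ej) V) φ := by
  have h : measuredState E₁ Ej V φ =
      conjBy (E₁ᴴ * Ej) V * taggedInput m φ * (conjBy (E₁ᴴ * Ej) V)ᴴ := by
    simp only [measuredState, preState, conjBy, conjTranspose_mul, conjTranspose_conjTranspose,
      Matrix.mul_assoc]
  rw [rejectProb, h, trace_tagProj_mul_conj, Complex.ofReal_re]

lemma integral_acceptProb_eq_haar {K : Type*} [MeasurableSpace K] {μ : Measure K}
    [IsProbabilityMeasure μ] {U : K → unitaryGroup (Bits n × Bits m) ℂ} (hU : Measurable U)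
    (hdes : IsExactDesign μ U 2) (A : Op n m) (φ : EuclideanSpace ℂ (Bits n)) :
    ∫ k, acceptProb (conjBy A (U k)) φ ∂μ =
      ∫ V, acceptProb (conjBy A V) φ ∂haarUnitary (Bits n × Bits m) := by
  -- Cycling one `V` to the front groups the unitaries into conjugates of `tagProj` and
  -- `taggedInput`, with `A` and `A†` fixed in between.
  have h : ∀ V : unitaryGroup (Bits n × Bits m) ℂ, ((acceptProb (conjBy A V) φ : ℝ) : ℂ) =
      (((V : Op n m) * tagProj n m * (V : Op n m)ᴴ) * A *
        ((V : Op n m) * taggedInput m φ * (V : Op n m)ᴴ) * Aᴴ).trace := by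
    intro V
    rw [← trace_tagProj_mul_conj, conjBy_conjTranspose, conjBy, conjBy, eq_comm]
    calc _ = ((V : Op n m) * (tagProj n m * ((V : Op n m)ᴴ * A * V * taggedInput m φ *
          ((V : Op n m)ᴴ * Aᴴ)))).trace := by simp only [Matrix.mul_assoc]
      _ = _ := by
        rw [trace_mul_comm]
        simp only [Matrix.mul_assoc]
  have key := hdes.integral_trace hU (tagProj n m) (taggedInput m φ) A Aᴴ
  simp only [← h] at key
  rw [integral_complex_ofReal, integral_complex_ofReal] at key
  exact_mod_cast key

lemma exists_unitary_column_zero (φ : EuclideanSpace ℂ (Bits n)) (hφ : ‖φ‖ = 1) :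
    ∃ W : unitaryGroup (Bits n) ℂ, ∀ i, (W : Matrix (Bits n) (Bits n) ℂ) i 0 = φ i := by
  obtain ⟨W, hW⟩ := exists_unitary_of_orthonormal (s := {(0 : Bits n)}) (v := fun _ => φ) (by
    rw [orthonormal_iff_ite]
    rintro ⟨i, hi⟩ ⟨j, hj⟩
    simp only [Set.mem_singleton_iff] at hi hj
    subst hi hj
    simp [Set.domRestrict_apply, inner_self_eq_norm_sq_to_K, hφ])
  exact ⟨W, hW 0 rfl⟩

/-- Conjugation by `W ⊗ 1` fixes `Π` and carries the basis input to `φ`. Under the Haar integral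
this rotation is absorbed by right invariance. -/
lemma acceptProb_rotate (W : unitaryGroup (Bits n) ℂ) (φ : EuclideanSpace ℂ (Bits n))
    (hW : ∀ i, (W : Matrix (Bits n) (Bits n) ℂ) i 0 = φ i) (B : Op n m) :
    acceptProb (((W : Matrix (Bits n) (Bits n) ℂ) ⊗ₖ (1 : Matrix (Bits m) (Bits m) ℂ))ᴴ * B *
      ((W : Matrix (Bits n) (Bits n) ℂ) ⊗ₖ (1 : Matrix (Bits m) (Bits m) ℂ)))
        (EuclideanSpace.single 0 1) = acceptProb B φ := by
  set T : Op n m := (W : Matrix (Bits n) (Bits n) ℂ) ⊗ₖ (1 : Matrix (Bits m) (Bits m) ℂ) with hT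
  have hcol : (W : Matrix (Bits n) (Bits n) ℂ) *ᵥ
      (EuclideanSpace.single (0 : Bits n) (1 : ℂ)).ofLp = φ.ofLp := by
    ext i
    simp [hW]
  have h1 : T * tagProj n m * Tᴴ = tagProj n m := by
    rw [hT, tagProj, conjTranspose_kronecker, ← mul_kronecker_mul, ← mul_kronecker_mul,
      Matrix.mul_one, unitary_mul_conjTranspose_self, conjTranspose_one, Matrix.one_mul,
      Matrix.mul_one]
  have h2 : T * taggedInput m (EuclideanSpace.single 0 1) * Tᴴ = taggedInput m φ := by
    rw [hT, taggedInput, taggedInput, conjTranspose_kronecker, ← mul_kronecker_mul,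
      ← mul_kronecker_mul, mul_vecMulVec, vecMulVec_mul, ← star_mulVec, hcol, conjTranspose_one,
      Matrix.one_mul, Matrix.mul_one]
  have h : (tagProj n m * ((Tᴴ * B * T) * taggedInput m (EuclideanSpace.single 0 1) *
      (Tᴴ * B * T)ᴴ)).trace = (tagProj n m * (B * taggedInput m φ * Bᴴ)).trace := by
    calc _ = ((tagProj n m * Tᴴ * B * (T * taggedInput m (EuclideanSpace.single 0 1) * Tᴴ) * Bᴴ) *
          T).trace := by
          simp only [conjTranspose_mul, conjTranspose_conjTranspose, Matrix.mul_assoc]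
      _ = ((T * tagProj n m * Tᴴ) * B * taggedInput m φ * Bᴴ).trace := by
          rw [trace_mul_comm, h2]
          simp only [Matrix.mul_assoc]
      _ = _ := by
          rw [h1]
          simp only [Matrix.mul_assoc]
  rw [trace_tagProj_mul_conj, trace_tagProj_mul_conj] at h
  exact_mod_cast h

lemma acceptProb_single (B : Op n m) :
    acceptProb B (EuclideanSpace.single 0 1) = ∑ x : Bits n, ‖B (x, 0) (0, 0)‖ ^ 2 := by
  have h : taggedVec m (EuclideanSpace.single (0 : Bits n) (1 : ℂ)) = Pi.single (0, 0) 1 := by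
    ext ⟨x, y⟩
    simp only [taggedVec, PiLp.single_apply, Pi.single_apply, Prod.mk.injEq]
    split_ifs <;> simp_all
  simp [acceptProb, h]

/-- A `1 × 1` unitary has nonzero trace. This excludes the degenerate case `n = m = 0`, where no
off-diagonal entry exists. -/
lemma exists_ne_of_unitary_of_trace_eq_zero {ι : Type*} [Fintype ι] [DecidableEq ι] [Nonempty ι]
    {A : Matrix ι ι ℂ} (hA : Aᴴ * A = 1) (htr : A.trace = 0) : ∃ b c : ι, b ≠ c := by
  by_contra! hne
  have hs : Subsingleton ι := ⟨hne⟩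
  obtain ⟨b⟩ := ‹Nonempty ι›
  have h0 : A b b = 0 := by
    rw [← htr, trace, Fintype.sum_subsingleton _ b, diag_apply]
  have h1 := congrFun (congrFun hA b) b
  rw [Matrix.mul_apply, Fintype.sum_subsingleton _ b, h0] at h1
  simp at h1

lemma integral_haar_acceptProb_le {A : Op n m} (hA : Aᴴ * A = 1) (htr : A.trace = 0)
    (φ : EuclideanSpace ℂ (Bits n)) (hφ : ‖φ‖ = 1) :
    ∫ V, acceptProb (conjBy A V) φ ∂haarUnitary (Bits n × Bits m) ≤ 8 * ((2 : ℝ) ^ m)⁻¹ := by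
  obtain ⟨W, hW⟩ := exists_unitary_column_zero φ hφ
  obtain ⟨b, c, hbc⟩ := exists_ne_of_unitary_of_trace_eq_zero hA htr
  have hrot : ∫ V, acceptProb (conjBy A V) φ ∂haarUnitary (Bits n × Bits m) =
      ∫ V, ∑ x : Bits n, ‖conjBy A V (x, 0) (0, 0)‖ ^ 2 ∂haarUnitary (Bits n × Bits m) := by
    simp only [← acceptProb_single, ← acceptProb_rotate W φ hW]
    exact integral_conjBy A (fun B => acceptProb B (EuclideanSpace.single 0 1))
      ⟨(W : Matrix (Bits n) (Bits n) ℂ) ⊗ₖ 1, kronecker_mem_unitary W.2 (one_mem _)⟩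
  have hint : ∀ x : Bits n, Integrable (fun V => ‖conjBy A V (x, 0) (0, 0)‖ ^ 2)
      (haarUnitary (Bits n × Bits m)) := fun x =>
    integrable_norm_sq_conjBy A (f := fun B => B (x, 0) (0, 0)) (continuous_id.matrix_elem _ _)
  rw [hrot, integral_finsetSum _ fun x _ => hint x,
    ← Finset.add_sum_erase _ _ (Finset.mem_univ (0 : Bits n))]
  have hcard := card_sub_one_mul_integral_offDiag_le hA hbc
  set g := ∫ V, ‖conjBy A V b c‖ ^ 2 ∂haarUnitary (Bits n × Bits m) with hg
  have hg0 : 0 ≤ g := integral_nonneg fun _ => by positivity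
  have hdiag : ∫ V, ‖conjBy A V (0, 0) (0, 0)‖ ^ 2 ∂haarUnitary (Bits n × Bits m) ≤ 4 * g := by
    obtain ⟨y, hy⟩ : ∃ y : Bits n × Bits m, (0, 0) ≠ y := by
      by_contra! h
      exact hbc ((h b).symm.trans (h c))
    rw [hg, ← integral_norm_sq_offDiag_eq A hbc hy]
    exact integral_norm_sq_diag_le htr hy
  have hoff : ∑ x ∈ Finset.univ.erase (0 : Bits n),
      ∫ V, ‖conjBy A V (x, 0) (0, 0)‖ ^ 2 ∂haarUnitary (Bits n × Bits m) =
        ((2 : ℝ) ^ n - 1) * g := by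
    rw [Finset.sum_congr rfl fun x hx => integral_norm_sq_offDiag_eq A hbc
      (x := (x, 0)) (y := (0, 0)) (by simpa using Finset.ne_of_mem_erase hx), Finset.sum_const,
      Finset.card_erase_of_mem (Finset.mem_univ _), Finset.card_univ, nsmul_eq_mul,
      Nat.cast_pred (Fintype.card_pos_iff.mpr ⟨0⟩)]
    simp [hg]
  have hD : (Fintype.card (Bits n × Bits m) : ℝ) = 2 ^ n * 2 ^ m := by simp
  have hD2 : (2 : ℝ) ≤ 2 ^ n * 2 ^ m := by
    rw [← hD]
    exact_mod_cast Fintype.one_lt_card_iff.mpr ⟨b, c, hbc⟩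
  have h2n : (1 : ℝ) ≤ 2 ^ n := one_le_pow₀ (by norm_num)
  rw [hD] at hcard
  -- For dimension `D ≥ 2`, `g ≤ (D - 1) g ≤ 1`, hence `D g ≤ 2`.
  have h1 : (2 : ℝ) ^ n * 2 ^ m * g ≤ 2 := by nlinarith
  rw [hoff, ← div_eq_mul_inv, le_div_iff₀ (by positivity)]
  -- One diagonal and `2^n - 1` off-diagonal terms give at most `(2^n + 3) g`, and `2^n + 3 ≤ 4 *
  -- 2^n`. With `h1` this yields the constant `8 = 4 * 2`.
  have h2 : ∫ V, ‖conjBy A V (0, 0) (0, 0)‖ ^ 2 ∂haarUnitary (Bits n × Bits m) +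
      ((2 : ℝ) ^ n - 1) * g ≤ 4 * (2 ^ n * g) := by nlinarith
  calc _ ≤ 4 * ((2 : ℝ) ^ n * g) * 2 ^ m := by gcongr
    _ ≤ 8 := by linarith

/-- The probability that one step with a wrong list error disturbs the state by more than `δ`,
by Markov's inequality. -/
lemma one_sub_le_measureReal_rejectProb {K : Type*} [MeasurableSpace K] {μ : Measure K}
    [IsProbabilityMeasure μ] {U : K → unitaryGroup (Bits n × Bits m) ℂ} (hU : Measurable U)
    (hdes : IsExactDesign μ U 2) (φ : EuclideanSpace ℂ (Bits n)) (hφ : ‖φ‖ = 1) {E₁ Ej : Op n m}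
    (hE₁ : IsPauli E₁) (hEj : IsPauli Ej) (hne : ∀ c : ℂ, E₁ ≠ c • Ej) {δ : ℝ} (hδ : 0 < δ) :
    1 - 8 * ((2 : ℝ) ^ m)⁻¹ / δ ≤ μ.real {k | 1 - δ ≤ rejectProb E₁ Ej (U k) φ} := by
  have hA : (E₁ᴴ * Ej)ᴴ * (E₁ᴴ * Ej) = 1 := by
    have h1 : E₁ * E₁ᴴ = 1 := mem_unitaryGroup_iff.mp hE₁.mem_unitaryGroup
    have h2 : Ejᴴ * Ej = 1 := mem_unitaryGroup_iff'.mp hEj.mem_unitaryGroup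
    rw [conjTranspose_mul, conjTranspose_conjTranspose, Matrix.mul_assoc, ← Matrix.mul_assoc E₁,
      h1, Matrix.one_mul, h2]
  set X : K → ℝ := fun k => acceptProb (conjBy (E₁ᴴ * Ej) (U k)) φ with hX
  have hXint : Integrable X μ :=
    integrable_continuous_comp hU ((continuous_acceptProb φ).comp (continuous_conjBy _))
  have hmarkov : δ * μ.real {k | δ ≤ X k} ≤ 8 * ((2 : ℝ) ^ m)⁻¹ :=
    (mul_meas_ge_le_integral_of_nonneg (ae_of_all _ fun k => acceptProb_nonneg _ _) hXint δ).trans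
      ((integral_acceptProb_eq_haar hU hdes _ φ).trans_le
        (integral_haar_acceptProb_le hA (hE₁.trace_conjTranspose_mul hEj hne) φ hφ))
  have hbad : μ.real {k | δ ≤ X k} ≤ 8 * ((2 : ℝ) ^ m)⁻¹ / δ := by
    rwa [le_div_iff₀ hδ, mul_comm]
  -- Covering the space by the two events and using subadditivity avoids any measurability argument
  -- for them.
  have hcover : {k | 1 - δ ≤ rejectProb E₁ Ej (U k) φ} ∪ {k | δ ≤ X k} = Set.univ := by
    refine Set.eq_univ_of_forall fun k => ?_
    rcases le_total δ (X k) with h | h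
    · exact Or.inr h
    · refine Or.inl ?_
      rw [Set.mem_ofPred_eq, rejectProb_eq]
      exact sub_le_sub_left h 1
  have hunion := measureReal_union_le (μ := μ) {k | 1 - δ ≤ rejectProb E₁ Ej (U k) φ}
    {k | δ ≤ X k}
  rw [hcover, probReal_univ] at hunion
  linarith

end Accept

/-! ### Growth conditions -/

section Growth

lemma negligible_of_eventually_le {f q : ℕ → ℝ} {C : ℝ} (hq : SuperLog q)
    (h : ∀ᶠ n in atTop, f n ≤ C * (2 : ℝ) ^ (-q n)) : Negligible f := by
  intro c
  have hlog2 : 0 < Real.log 2 := Real.log_pos one_lt_two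
  -- The exponent `c + 1` leaves a spare factor `n`, which eventually beats the constant `C` and
  -- makes the inequality strict.
  obtain ⟨n₀, hn₀⟩ := eventually_atTop.mp ((h.and (hq ((c + 1) / Real.log 2))).and
    ((eventually_gt_atTop 0).and (tendsto_natCast_atTop_atTop.eventually_gt_atTop (max C 0))))
  refine ⟨n₀, fun n hn => ?_⟩
  obtain ⟨⟨hf, hqn⟩, hn0, hnC⟩ := hn₀ n hn.le
  have hnpos : (0 : ℝ) < n := by exact_mod_cast hn0
  have hpow : (2 : ℝ) ^ (-q n) ≤ ((n : ℝ) ^ (c + 1))⁻¹ := by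
    rw [Real.rpow_def_of_pos two_pos, ← Real.exp_log (pow_pos hnpos (c + 1)), ← Real.exp_neg,
      Real.log_pow, Real.exp_le_exp]
    rw [div_mul_eq_mul_div, div_le_iff₀ hlog2] at hqn
    push_cast
    linarith
  calc f n ≤ C * (2 : ℝ) ^ (-q n) := hf
    _ ≤ max C 0 * ((n : ℝ) ^ (c + 1))⁻¹ :=
      mul_le_mul (le_max_left _ _) hpow (by positivity) (le_max_right _ _)
    _ < n * ((n : ℝ) ^ (c + 1))⁻¹ := by gcongr
    _ = ((n : ℝ) ^ c)⁻¹ := by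
      rw [pow_succ]
      field_simp

lemma exists_polyLog_superLog {m : ℕ → ℝ} (hm : SuperLog m) :
    ∃ p : ℕ → ℝ, PolyLog p ∧ SuperLog p ∧ SuperLog (fun n => m n - p n) := by
  have hhalf : ∀ c : ℝ, ∀ᶠ n : ℕ in atTop, c * Real.log n ≤ m n / 2 := fun c =>
    (hm (2 * c)).mono fun n hn => by linarith
  -- The cap `log² n` keeps `p` polylogarithmic yet superlogarithmic; the cap `m / 2` leaves at
  -- least `m / 2` for `m - p`.
  refine ⟨fun n => min (m n / 2) (Real.log n ^ 2), ⟨2, ?_⟩, fun c => ?_, fun c => ?_⟩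
  · refine IsBigO.of_bound 1 ?_
    filter_upwards [hhalf 0] with n hn
    rw [zero_mul] at hn
    rw [one_mul, Real.norm_of_nonneg (le_min hn (sq_nonneg _)), Real.norm_of_nonneg (sq_nonneg _)]
    exact min_le_right _ _
  · filter_upwards [hhalf c,
      (Real.tendsto_log_atTop.comp tendsto_natCast_atTop_atTop).eventually_ge_atTop (max c 0)]
      with n hn hlog
    have hlog' : max c 0 ≤ Real.log n := hlog
    refine le_min hn ?_
    rw [sq]
    exact mul_le_mul_of_nonneg_right ((le_max_left _ _).trans hlog') ((le_max_right _ _).trans hlog')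
  · filter_upwards [hhalf c] with n hn
    have := min_le_left (m n / 2) (Real.log n ^ 2)
    linarith

lemma negligible_of_isBigO {δ : ℕ → ℝ} {m : ℕ → ℕ} {p : ℕ → ℝ}
    (hmp : SuperLog fun n => (m n : ℝ) - p n)
    (h : δ =O[atTop] fun n => (2 : ℝ) ^ (-(m n : ℝ) + p n)) : Negligible δ := by
  obtain ⟨C, hC⟩ := h.bound
  refine negligible_of_eventually_le (C := C) hmp (hC.mono fun n hn => ?_)
  rw [Real.norm_of_nonneg (by positivity : (0 : ℝ) ≤ 2 ^ (-(m n : ℝ) + p n))] at hn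
  rw [neg_sub, sub_eq_neg_add]
  exact (le_abs_self _).trans hn

lemma negligible_div {C : ℝ} (hC : 0 < C) {m : ℕ → ℕ} {p ε δ : ℕ → ℝ} (hp : SuperLog p)
    (hε : ε =O[atTop] fun n => ((2 : ℝ) ^ m n)⁻¹) (hδ : ∀ n, 0 < δ n)
    (hδp : (fun n => (2 : ℝ) ^ (-(m n : ℝ) + p n)) =O[atTop] δ) :
    Negligible fun n => C * (((2 : ℝ) ^ m n)⁻¹ + ε n) / δ n := by
  obtain ⟨A, hA⟩ := hε.bound
  obtain ⟨B, hB0, hB⟩ := hδp.exists_pos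
  refine negligible_of_eventually_le (C := C * (1 + |A|) * B) hp ?_
  filter_upwards [hA, hB.bound] with n hAn hBn
  rw [Real.norm_of_nonneg (by positivity : (0 : ℝ) ≤ ((2 : ℝ) ^ m n)⁻¹)] at hAn
  rw [Real.norm_of_nonneg (by positivity : (0 : ℝ) ≤ 2 ^ (-(m n : ℝ) + p n)),
    Real.norm_of_nonneg (hδ n).le, Real.rpow_add two_pos, Real.rpow_neg two_pos.le,
    Real.rpow_natCast] at hBn
  have hε' : ε n ≤ |A| * ((2 : ℝ) ^ m n)⁻¹ :=
    (le_abs_self _).trans (hAn.trans (by gcongr; exact le_abs_self A))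
  -- The lower bound on `δ` of order `2^(-m+p)` means that dividing `2^(-m)` by `δ` leaves order
  -- `2^(-p)`.
  have hm : ((2 : ℝ) ^ m n)⁻¹ ≤ B * δ n * (2 : ℝ) ^ (-p n) := by
    rw [Real.rpow_neg two_pos.le, ← div_eq_mul_inv, le_div_iff₀ (by positivity)]
    exact hBn
  rw [div_le_iff₀ (hδ n)]
  calc C * (((2 : ℝ) ^ m n)⁻¹ + ε n) ≤ C * ((1 + |A|) * ((2 : ℝ) ^ m n)⁻¹) := by
        gcongr; linarith
    _ ≤ C * ((1 + |A|) * (B * δ n * (2 : ℝ) ^ (-p n))) := by gcongr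
    _ = _ := by ring

end Growth

end QListDecoding

theorem proposition2 :
    ∃ C : ℝ, 0 < C ∧
      -- one step with a wrong list error, with explicit dependence on all parameters
      (∀ (n m : ℕ) (ε δ : ℝ), 0 ≤ ε → 0 < δ →
        ∀ (K : Type*) [MeasurableSpace K] (μ : Measure K) [IsProbabilityMeasure μ]
          (U : K → unitaryGroup (Bits n × Bits m) ℂ),
          Measurable U →
          IsExactDesign μ U 2 →
          IsRelApproxDesign μ U 4 ε →
        ∀ (φ : EuclideanSpace ℂ (Bits n)), ‖φ‖ = 1 →
        ∀ (E₁ Ej : Op n m), IsPauli E₁ → IsPauli Ej → (∀ c : ℂ, E₁ ≠ c • Ej) →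
          (∀ k : K,
            ((fidelity (postState E₁ Ej (U k) φ) (preState Ej (U k) φ) : ℝ) : ℂ) =
              (postState E₁ Ej (U k) φ * preState Ej (U k) φ).trace) ∧
          1 - C * (((2 : ℝ) ^ m)⁻¹ + ε) / δ ≤
            μ.real {k : K |
              1 - δ ≤ fidelity (postState E₁ Ej (U k) φ) (preState Ej (U k) φ)}) ∧
      -- the asymptotic regime: both error terms are negligible
      (∀ m : ℕ → ℕ, SuperLog (fun n => (m n : ℝ)) →
        (∃ p : ℕ → ℝ, PolyLog p ∧ SuperLog p ∧ SuperLog (fun n => (m n : ℝ) - p n)) ∧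
        ∀ p : ℕ → ℝ, PolyLog p → SuperLog p → SuperLog (fun n => (m n : ℝ) - p n) →
        ∀ ε : ℕ → ℝ, (∀ n, 0 ≤ ε n) → ε =O[atTop] (fun n => ((2 : ℝ) ^ m n)⁻¹) →
        ∀ δ : ℕ → ℝ, (∀ n, 0 < δ n) →
          δ =Θ[atTop] (fun n => (2 : ℝ) ^ (-(m n : ℝ) + p n)) →
          Negligible δ ∧
          Negligible (fun n => C * (((2 : ℝ) ^ m n)⁻¹ + ε n) / δ n)) := by
  refine ⟨8, by norm_num, ?_, ?_⟩
  · intro n m ε δ hε hδ K _ μ _ U hU hdes _ φ hφ E₁ Ej hE₁ hEj hne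
    have hstep := fun k => fidelity_postState (mem_unitaryGroup_iff'.mp hE₁.mem_unitaryGroup)
      (mem_unitaryGroup_iff'.mp hEj.mem_unitaryGroup) (unitary_conjTranspose_mul_self (U k)) φ hφ
    refine ⟨fun k => ?_, ?_⟩
    · rw [(hstep k).1, (hstep k).2]
    · simp only [fun k => (hstep k).1]
      refine le_trans ?_ (one_sub_le_measureReal_rejectProb hU hdes φ hφ hE₁ hEj hne hδ)
      -- The Markov bound involves `2^(-m)` alone; adding `ε ≥ 0` only weakens it.
      gcongr
      linarith
  · intro m hm
    refine ⟨exists_polyLog_superLog hm, fun p _ hp hmp ε _ hε δ hδ hδΘ => ?_⟩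
    exact ⟨negligible_of_isBigO hmp hδΘ.1, negligible_div (by norm_num) hp hε hδ hδΘ.2⟩
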